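/- Let $M=[m]$ be a set of goods. A valuation on $M$ is a function $v:2^M\to\mathbb{R}_{\ge 0}$ with $v(\emptyset)=0$ and $v(S)\le v(T)$ whenever $S\subseteq T$; it is submodular if $v(S\cup\{x\})-v(S)\ge v(T\cup\{x\})-v(T)$ for all $S\subseteq T\subseteq M$ and $x\notin T$. An allocation to $n$ players with valuations $v_1,\dots,v_n$ is a tuple $(A_1,\dots,A_n)$ of pairwise disjoint (possibly empty) sets with union $M$; it is EFX (envy-free up to any good) if $v_i(A_i)\ge v_i(A_j\setminus\{g\})$ for all players $i,j$ and all $g\in A_j$. A deterministic algorithm learns the valuations only through adaptive value queries; all other operations are free. Querying $v_i$ at $S$ returns $v_i(S)$. For a class $\mathcal{C}$ of valuations on $[m]$, let $D[\mathrm{EFX}_{id}(n,m);\mathcal{C}]$ be the minimum, over all deterministic algorithms that output an EFX allocation for $n$ players who all have the valuation $v$, for every $v\in\mathcal{C}$, of the maximum over $v\in\mathcal{C}$ of the number of value queries made on $v$. Let $D[\mathrm{EFX}_{id}(n,m)]$ be this quantity for the class of all valuations, and let $D[\mathrm{EFX}(n,m)]$ be the analogous quantity for $n$ arbitrary, possibly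 distinct, valuations, where the algorithm must output an EFX allocation or report that none exists. **Theorem.** There is an absolute constant $c>0$ such that for every integer $k\ge 1$ $$D[\mathrm{EFX}_{id}(2,2k+1)]\ \ge\ \frac{c}{k}\binom{2k+1}{k},$$ that is, $D[\mathrm{EFX}_{id}(2,2k+1)]\in\Omega\left(\frac1k\binom{2k+1}{k}\right)$. The same lower bound, with the same $c$, holds for $D[\mathrm{EFX}_{id}(2,2k+1);\mathcal{C}]$ with $\mathcal{C}$ the class of submodular valuations on $[2k+1]$, and for $D[\mathrm{EFX}(2,2k+1)]$. -/

import Mathlib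

open scoped ENNReal

namespace FairDivision

/-- A deterministic adaptive query algorithm, as a decision tree: it either stops with an output,
or makes a query `q : Q` and continues in a way that depends on the answer `r : R`.
Everything except the queries is free. -/
inductive QueryAlgorithm (Q R O : Type) : Type
  | output (o : O) : QueryAlgorithm Q R O
  | query (q : Q) (next : R → QueryAlgorithm Q R O) : QueryAlgorithm Q R O

namespace QueryAlgorithm

variable {Q R O : Type}

/-- The output of the algorithm when its queries are answered by the oracle `f`. -/
def run : QueryAlgorithm Q R O → (Q → R) → O
  | output o, _ => o
  | query q next, f => run (next (f q)) f

/-- The number of queries that the algorithm makes when they are answered by the oracle `f`. -/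
def numQueries : QueryAlgorithm Q R O → (Q → R) → ℕ
  | output _, _ => 0
  | query q next, f => numQueries (next (f q)) f + 1

end QueryAlgorithm

/-- The deterministic query complexity of a search problem with set of inputs `I`, where the
input `x` is accessible only through the oracle `oracle x`, and `valid x` is the set of correct
outputs on `x`: the minimum, over all deterministic algorithms that are correct on every input,
of the worst-case number of queries (`⊤` if there is no bound). -/
noncomputable def detQueryComplexity {I Q R O : Type} (oracle : I → Q → R)
    (valid : I → Set O) : ℕ∞ :=
  ⨅ (Γ : QueryAlgorithm Q R O) (_ : ∀ x, Γ.run (oracle x) ∈ valid x),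
    ⨆ x, (Γ.numQueries (oracle x) : ℕ∞)

/-- A (general) valuation on the goods `[m]`: a normalized monotone set function.
It is nonnegative, since `0 = v ∅ ≤ v S`. -/
structure Valuation (m : ℕ) where
  /-- the value of a set of goods -/
  val : Finset (Fin m) → ℝ
  val_empty : val ∅ = 0
  val_mono : ∀ S T : Finset (Fin m), S ⊆ T → val S ≤ val T

/-- Diminishing returns. -/
def Valuation.IsSubmodular {m : ℕ} (v : Valuation m) : Prop :=
  ∀ (S T : Finset (Fin m)) (x : Fin m), S ⊆ T → x ∉ T →
    v.val (insert x T) - v.val T ≤ v.val (insert x S) - v.val S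

/-- An allocation of all the goods `[m]` to the players `[n]`: pairwise disjoint bundles (some of
which may be empty) that together contain every good. -/
structure Allocation (n m : ℕ) where
  /-- the bundle of each player -/
  bundle : Fin n → Finset (Fin m)
  disjoint : ∀ i j, i ≠ j → Disjoint (bundle i) (bundle j)
  cover : ∀ g : Fin m, ∃ i, g ∈ bundle i

/-- The allocation is envy-free up to any good for the valuations `v 0, …, v (n - 1)`. -/
def Allocation.IsEFX {n m : ℕ} (A : Allocation n m) (v : Fin n → Valuation m) : Prop :=
  ∀ i j, ∀ g ∈ A.bundle j, (v i).val (A.bundle j \ {g}) ≤ (v i).val (A.bundle i)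

/-- The deterministic query complexity of finding an EFX allocation of the goods `[m]` to `n`
players who all have the same valuation `v`, where `v` is promised to belong to the class `C`
and is accessible through value queries. -/
noncomputable def efxIdComplexityOn (n m : ℕ) (C : Set (Valuation m)) : ℕ∞ :=
  detQueryComplexity (I := {v : Valuation m // v ∈ C}) (fun v => v.1.val)
    (fun v => {A : Allocation n m | A.IsEFX (fun _ => v.1)})

/-- `D[EFX_id(n, m)]`: `n` players with the same general valuation, `m` goods. -/
noncomputable def efxIdComplexity (n m : ℕ) : ℕ∞ :=
  efxIdComplexityOn n m Set.univ

/-- The deterministic query complexity of the EFX allocation problem for `n` players with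
arbitrary, possibly distinct, valuations and `m` goods. A query `(i, S)` returns the value of `S`
to player `i`. The algorithm has to return an EFX allocation, or `none` if there is none. -/
noncomputable def efxComplexity (n m : ℕ) : ℕ∞ :=
  detQueryComplexity (I := Fin n → Valuation m) (Q := Fin n × Finset (Fin m))
    (fun v q => (v q.1).val q.2)
    (fun v => {o : Option (Allocation n m) |
      (∃ A, o = some A ∧ A.IsEFX v) ∨ (o = none ∧ ¬ ∃ A : Allocation n m, A.IsEFX v)})

end FairDivision

/-!
The lower bound comes from local search on the odd graph, whose vertices are the `k`-subsets of the
`2 * k + 1` goods and whose edges join disjoint sets.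

*Reduction.* A function `f` on the vertices is encoded in a valuation that is a strictly concave
increasing function of the size of a set, plus a small perturbation on the sets of size `k` that is
increasing in `f` (`codeValuation`). Such a valuation is monotone and submodular, whatever `f` is.
For two players with this valuation, an EFX allocation splits the goods into a `k`-set `A` and its
complement, and the sets that arise from the complement by removing one good are the neighbours of
`A`; hence `A` is a local maximum of `f` (`Allocation.IsEFX.isLocalMax`). An EFX allocation exists
in this case, so that the option to report that there is none does not help. One value query
reveals at most one value of `f`, so `le_detQueryComplexity_of_reduction` applies to all three
complexities.

*Local search.* An adversary keeps a large connected component `C` of the graph without the vertices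
queried so far, and a function whose only possible local maximum lies in `C`. When a vertex of `C`
is queried, the adversary passes to the large component that remains, and gives the vertices it
drops from `C` new values, larger than all old ones and decreasing with the distance from a vertex
of the new component (`NoLocalMaxExcept.move`). No answer given before is changed, and the
algorithm cannot name a local maximum as long as a large component exists.

*Separators.* It remains to see that a large component exists until `N / (8 * k)` vertices have been
removed, where `N` is the number of vertices. This holds because the odd graph has edge expansion:
in an arc-transitive graph of degree `d` and diameter at most `D`, at least
`d * |C| * |V \ C| / (D * N)` edges leave a set `C` (`IsArcTransitive.card_mul_card_compl_le`), as
one sees by averaging the walks between all pairs of vertices over the automorphism group. If all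
components had at most `N / 2` vertices, then more edges would leave them than the few removed
vertices can meet (`IsArcTransitive.exists_large_comp`).
-/

/-! ### Edge expansion of arc-transitive graphs -/

namespace SimpleGraph

variable {V : Type*} {G : SimpleGraph V}

/-- Every arc (ordered pair of adjacent vertices) can be carried to every other by an automorphism. -/
def IsArcTransitive (G : SimpleGraph V) : Prop :=
  ∀ a b a' b' : V, G.Adj a b → G.Adj a' b' → ∃ φ : G ≃g G, φ a = a' ∧ φ b = b'

section Expansion

variable [Fintype V]

open scoped Classical in
/-- The arcs of `G` that lead out of `C`. -/
noncomputable def outArcs (G : SimpleGraph V) (C : Finset V) : Finset (V × V) :=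
  {p | G.Adj p.1 p.2 ∧ p.1 ∈ C ∧ p.2 ∉ C}

noncomputable instance fintypeAut : Fintype (G ≃g G) :=
  haveI := Classical.decEq V
  Fintype.ofInjective (fun φ : G ≃g G => (φ : V → V)) DFunLike.coe_injective

open scoped Classical in
/-- The number of automorphisms of `G` that carry `u` into `C` and `v` out of `C`. -/
noncomputable def separatingCount (G : SimpleGraph V) (C : Finset V) (u v : V) : ℕ :=
  Finset.card {φ : G ≃g G | φ u ∈ C ∧ φ v ∉ C}

theorem separatingCount_self (C : Finset V) (u : V) : G.separatingCount C u u = 0 := by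
  simp [separatingCount]

theorem separatingCount_triangle (C : Finset V) (u v w : V) :
    G.separatingCount C u w ≤ G.separatingCount C u v + G.separatingCount C v w := by
  classical
  unfold separatingCount
  refine le_trans (Finset.card_le_card ?_) (Finset.card_union_le _ _)
  intro φ hφ
  simp only [Finset.mem_filter, Finset.mem_univ, true_and, Finset.mem_union] at hφ ⊢
  tauto

theorem separatingCount_apply (C : Finset V) (ψ : G ≃g G) (u v : V) :
    G.separatingCount C (ψ u) (ψ v) = G.separatingCount C u v := by
  classical
  unfold separatingCount
  refine Finset.card_bij (fun φ _ => ψ.trans φ) ?_ ?_ ?_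
  · intro φ hφ
    simpa using hφ
  · intro φ _ φ' _ h
    ext x
    simpa using DFunLike.congr_fun h (ψ.symm x)
  · intro φ hφ
    exact ⟨ψ.symm.trans φ, by simpa using hφ, by ext x; simp⟩

theorem separatingCount_le_length_mul (C : Finset V) {c : ℕ}
    (hc : ∀ a b, G.Adj a b → G.separatingCount C a b ≤ c) {u v : V} (p : G.Walk u v) :
    G.separatingCount C u v ≤ p.length * c := by
  induction p with
  | nil => simp [separatingCount_self]
  | @cons u v w h p ih =>
    have h1 := separatingCount_triangle (G := G) C u v w
    have h2 := hc u v h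
    rw [Walk.length_cons, add_mul, one_mul]
    omega

/-- Double counting: summing `separatingCount` over a set of pairs that is invariant under
automorphisms counts each separated pair once for every automorphism. -/
theorem sum_separatingCount (C : Finset V) (P : V → V → Prop) [DecidableRel P] [DecidableEq V]
    (hP : ∀ (φ : G ≃g G) u v, P (φ u) (φ v) ↔ P u v) :
    ∑ p : V × V with P p.1 p.2, G.separatingCount C p.1 p.2 =
      Fintype.card (G ≃g G) * Finset.card {p : V × V | P p.1 p.2 ∧ p.1 ∈ C ∧ p.2 ∉ C} := by
  classical
  unfold separatingCount
  simp_rw [Finset.card_eq_sum_ones, Finset.sum_filter]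
  rw [← Finset.sum_filter, Finset.sum_comm]
  rw [← smul_eq_mul, ← Finset.card_univ, ← Finset.sum_const]
  refine Finset.sum_congr rfl fun φ _ => ?_
  rw [Finset.sum_filter]
  refine Fintype.sum_equiv (φ.toEquiv.prodCongr φ.toEquiv) _ _ fun p => ?_
  simp only [Equiv.prodCongr_apply, Prod.map_fst, Prod.map_snd, RelIso.coe_fn_toEquiv, hP]
  by_cases h : P p.1 p.2 <;> simp [h]

theorem IsRegularOfDegree.card_arcs [DecidableRel G.Adj] {d : ℕ} (hd : G.IsRegularOfDegree d) :
    Finset.card {p : V × V | G.Adj p.1 p.2} = Fintype.card V * d := by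
  rw [Finset.card_filter, Fintype.sum_prod_type]
  simp_rw [← Finset.card_filter, ← neighborFinset_eq_filter, card_neighborFinset_eq_degree,
    hd.degree_eq]
  simp

/-- Edge expansion. Moving fixed walks of length at most `D` between all pairs of vertices by all
automorphisms spreads them evenly over the arcs, and each walk from `C` to its complement uses an
arc out of `C`. -/
theorem IsArcTransitive.card_mul_card_compl_le [DecidableRel G.Adj] (hG : G.IsArcTransitive)
    {d D : ℕ} (hd : G.IsRegularOfDegree d) (hD : ∀ u v, ∃ p : G.Walk u v, p.length ≤ D)
    [DecidableEq V] (C : Finset V) :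
    d * (C.card * Cᶜ.card) ≤ D * Fintype.card V * (G.outArcs C).card := by
  classical
  obtain ⟨c, hc⟩ : ∃ c, ∀ a b, G.Adj a b → G.separatingCount C a b = c := by
    by_cases h : ∃ a b, G.Adj a b
    · obtain ⟨a, b, hab⟩ := h
      refine ⟨G.separatingCount C a b, fun a' b' h' => ?_⟩
      obtain ⟨φ, rfl, rfl⟩ := hG a b a' b' hab h'
      exact separatingCount_apply C φ a b
    · exact ⟨0, fun a b hab => (h ⟨a, b, hab⟩).elim⟩
  have harcs := sum_separatingCount (G := G) C G.Adj fun φ u v => φ.map_adj_iff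
  rw [Finset.sum_congr rfl (g := fun _ => c)
    (fun p hp => hc _ _ (Finset.mem_filter.1 hp).2), Finset.sum_const, hd.card_arcs,
    smul_eq_mul] at harcs
  have hpairs := sum_separatingCount (G := G) C (fun _ _ => True) fun _ _ _ => Iff.rfl
  have hprod : Finset.card {p : V × V | True ∧ p.1 ∈ C ∧ p.2 ∉ C} = C.card * Cᶜ.card := by
    rw [← Finset.card_product]
    congr 1
    ext p
    simp
  rw [hprod] at hpairs
  have hle : ∑ p : V × V with True, G.separatingCount C p.1 p.2 ≤
      Fintype.card V * Fintype.card V * (D * c) := by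
    refine (Finset.sum_le_card_nsmul _ _ (D * c) fun p _ => ?_).trans (by simp)
    obtain ⟨w, hw⟩ := hD p.1 p.2
    exact (separatingCount_le_length_mul C (fun a b h => (hc a b h).le) w).trans
      (Nat.mul_le_mul_right _ hw)
  rw [hpairs] at hle
  have hout : Finset.card {p : V × V | G.Adj p.1 p.2 ∧ p.1 ∈ C ∧ p.2 ∉ C} =
      (G.outArcs C).card := by
    unfold outArcs
    congr
  rw [hout] at harcs
  have hpos : 0 < Fintype.card (G ≃g G) := Fintype.card_pos_iff.2 ⟨RelIso.refl _⟩
  refine Nat.le_of_mul_le_mul_left ?_ hpos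
  calc Fintype.card (G ≃g G) * (d * (C.card * Cᶜ.card))
      = d * (Fintype.card (G ≃g G) * (C.card * Cᶜ.card)) := by ring
    _ ≤ d * (Fintype.card V * Fintype.card V * (D * c)) := Nat.mul_le_mul_left _ hle
    _ = D * Fintype.card V * (Fintype.card V * d * c) := by ring
    _ = _ := by rw [harcs]; ring

end Expansion

/-! ### Small vertex sets do not separate -/

/-- The graph `G` with all edges at vertices of `Q` removed. -/
def isolate (G : SimpleGraph V) (Q : Finset V) : SimpleGraph V where
  Adj u v := G.Adj u v ∧ u ∉ Q ∧ v ∉ Q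
  symm := ⟨fun _ _ h => ⟨h.1.symm, h.2.2, h.2.1⟩⟩
  loopless := ⟨fun _ h => h.1.ne rfl⟩

theorem isolate_anti {Q Q' : Finset V} (h : Q ⊆ Q') : G.isolate Q' ≤ G.isolate Q :=
  fun _ _ huv => ⟨huv.1, fun hu => huv.2.1 (h hu), fun hv => huv.2.2 (h hv)⟩

variable [Fintype V]

open scoped Classical in
/-- The vertices of the connected component of `r` in `G` with the edges at `Q` removed. -/
noncomputable def comp (G : SimpleGraph V) (Q : Finset V) (r : V) : Finset V :=
  {x | (G.isolate Q).Reachable r x}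

theorem mem_comp {Q : Finset V} {r x : V} : x ∈ G.comp Q r ↔ (G.isolate Q).Reachable r x := by
  simp [comp]

/-- The arcs that leave a component of `G.isolate Q` all meet `Q`, and the regularity leaves few
of those; by edge expansion, there would be too many of them if every component were small. -/
theorem IsArcTransitive.exists_large_comp [DecidableRel G.Adj] (hG : G.IsArcTransitive)
    {d D : ℕ} (hd : G.IsRegularOfDegree d) (hd0 : 0 < d)
    (hD : ∀ u v, ∃ p : G.Walk u v, p.length ≤ D) {Q : Finset V}
    (hQ : 4 * D * Q.card < Fintype.card V) :
    ∃ r, Fintype.card V < 2 * (G.comp Q r).card := by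
  classical
  by_contra! hsmall
  set N := Fintype.card V with hN
  let π : V → (G.isolate Q).ConnectedComponent := (G.isolate Q).connectedComponentMk
  have hfiber : ∀ r, ({x | π x = π r} : Finset V) = G.comp Q r := by
    intro r
    ext x
    simp only [Finset.mem_filter, Finset.mem_univ, true_and, mem_comp, π, ConnectedComponent.eq]
    exact ⟨Reachable.symm, Reachable.symm⟩
  have hexp : ∀ r, d * (G.comp Q r).card ≤ 2 * D * (G.outArcs (G.comp Q r)).card := by
    intro r
    have h1 := hG.card_mul_card_compl_le hd hD (G.comp Q r)
    have h2 := Finset.card_compl (G.comp Q r)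
    have h3 := hsmall r
    have h4 : N ≤ 2 * (G.comp Q r)ᶜ.card := by omega
    have hNpos : 0 < N := by omega
    refine Nat.le_of_mul_le_mul_right ?_ hNpos
    calc d * (G.comp Q r).card * N
        ≤ d * (G.comp Q r).card * (2 * (G.comp Q r)ᶜ.card) := Nat.mul_le_mul_left _ h4
      _ = 2 * (d * ((G.comp Q r).card * (G.comp Q r)ᶜ.card)) := by ring
      _ ≤ 2 * (D * N * (G.outArcs (G.comp Q r)).card) := Nat.mul_le_mul_left _ h1
      _ = _ := by ring
  -- the arcs between different components
  let B : Finset (V × V) := {p | G.Adj p.1 p.2 ∧ π p.1 ≠ π p.2}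
  have hsumB : B.card = ∑ c : (G.isolate Q).ConnectedComponent,
      (Finset.card {p ∈ B | π p.1 = c}) :=
    Finset.card_eq_sum_card_fiberwise fun _ _ => Finset.mem_coe.2 (Finset.mem_univ _)
  have hsumN : N = ∑ c : (G.isolate Q).ConnectedComponent,
      (Finset.card {x : V | π x = c}) := by
    rw [hN, ← Finset.card_univ]
    exact Finset.card_eq_sum_card_fiberwise fun _ _ => Finset.mem_coe.2 (Finset.mem_univ _)
  have hlow : d * N ≤ 2 * D * B.card := by
    rw [hsumN, hsumB, Finset.mul_sum, Finset.mul_sum]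
    refine Finset.sum_le_sum fun c _ => ?_
    induction c using ConnectedComponent.ind with | _ r =>
    change d * Finset.card {x : V | π x = π r} ≤ 2 * D * Finset.card {p ∈ B | π p.1 = π r}
    rw [hfiber]
    refine (hexp r).trans_eq ?_
    congr 2
    ext p
    simp only [outArcs, B, ← hfiber, Finset.mem_filter, Finset.mem_univ, true_and]
    constructor
    · rintro ⟨h1, h2, h3⟩
      exact ⟨⟨h1, fun h => h3 (h ▸ h2)⟩, h2⟩
    · rintro ⟨⟨h1, h2⟩, h3⟩
      exact ⟨h1, h3, fun h => h2 (h3.trans h.symm)⟩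
  have hB : B.card ≤ Q.card * d + Q.card * d := by
    have hsub : B ⊆ (Q.biUnion fun q => (G.neighborFinset q).image fun x => (q, x)) ∪
        (Q.biUnion fun q => (G.neighborFinset q).image fun x => (x, q)) := by
      rintro ⟨x, y⟩ hp
      obtain ⟨hxy, hne⟩ := (Finset.mem_filter.1 hp).2
      by_cases hx : x ∈ Q
      · refine Finset.mem_union_left _ (Finset.mem_biUnion.2 ⟨x, hx, ?_⟩)
        exact Finset.mem_image_of_mem _ ((mem_neighborFinset _ _ _).2 hxy)
      by_cases hy : y ∈ Q
      · refine Finset.mem_union_right _ (Finset.mem_biUnion.2 ⟨y, hy, ?_⟩)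
        exact Finset.mem_image_of_mem (fun x => (x, y)) ((mem_neighborFinset _ _ _).2 hxy.symm)
      · exact (hne (ConnectedComponent.sound (Adj.reachable ⟨hxy, hx, hy⟩))).elim
    refine (Finset.card_le_card hsub).trans ((Finset.card_union_le _ _).trans ?_)
    refine Nat.add_le_add ?_ ?_ <;>
    · refine Finset.card_biUnion_le_card_mul _ _ _ fun q _ => Finset.card_image_le.trans ?_
      rw [card_neighborFinset_eq_degree, hd.degree_eq]
  have hfin : d * N ≤ d * (4 * D * Q.card) := by
    calc d * N ≤ 2 * D * (Q.card * d + Q.card * d) := hlow.trans (Nat.mul_le_mul_left _ hB)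
      _ = _ := by ring
  exact absurd (Nat.le_of_mul_le_mul_left hfin hd0) (by omega)

end SimpleGraph

/-! ### The adversary against local search -/

namespace SimpleGraph

variable {V : Type*} [Fintype V] {G : SimpleGraph V}

/-- Every vertex other than `r` has a neighbour with a larger value of `f`, so that no vertex
other than `r` is a local maximum of `f`. -/
def NoLocalMaxExcept (G : SimpleGraph V) (f : V → ℕ) (r : V) : Prop :=
  ∀ x, x ≠ r → ∃ y, G.Adj x y ∧ f x < f y

/-- The only candidate for a local maximum can be moved to any vertex `r'` of the component
containing it, changing `f` inside the component only: there, the new values exceed all old ones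
and decrease with the distance from `r'`. -/
theorem NoLocalMaxExcept.move {f : V → ℕ} {Q : Finset V} {r r' : V}
    (hf : G.NoLocalMaxExcept f r) (hr' : r' ∈ G.comp Q r) :
    ∃ f' : V → ℕ, (∀ x ∉ G.comp Q r, f' x = f x) ∧ G.NoLocalMaxExcept f' r' := by
  classical
  set H := G.isolate Q with hH
  set C := G.comp Q r with hC
  have hrr' : H.Reachable r r' := mem_comp.1 hr'
  let δ : V → ℕ := fun x => H.dist r' x
  let M : ℕ := ∑ x, f x + ∑ x, δ x + 1
  have hfM : ∀ x, f x ≤ ∑ x, f x := fun x =>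
    Finset.single_le_sum (fun _ _ => Nat.zero_le _) (Finset.mem_univ x)
  have hδM : ∀ x, δ x ≤ ∑ x, δ x := fun x =>
    Finset.single_le_sum (fun _ _ => Nat.zero_le _) (Finset.mem_univ x)
  refine ⟨fun x => if x ∈ C then M - δ x else f x, fun x hx => if_neg hx, fun x hx => ?_⟩
  by_cases hxC : x ∈ C
  · have hreach : H.Reachable x r' := (mem_comp.1 hxC).symm.trans hrr'
    obtain ⟨p, hp⟩ := hreach.exists_walk_length_eq_dist
    cases p with
    | nil => exact (hx rfl).elim
    | @cons _ y _ hxy p =>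
      have hyC : y ∈ C := mem_comp.2 ((mem_comp.1 hxC).trans hxy.reachable)
      refine ⟨y, hxy.1, ?_⟩
      have hdist : δ y < δ x := by
        have h1 : H.dist y r' ≤ p.length := dist_le p
        rw [Walk.length_cons] at hp
        change H.dist r' y < H.dist r' x
        rw [H.dist_comm (u := r') (v := y), H.dist_comm (u := r') (v := x)]
        omega
      have := hδM x
      simp only [hxC, hyC, if_true]
      omega
  · have hxr : x ≠ r := by
      rintro rfl
      exact hxC (mem_comp.2 (Reachable.refl _))
    obtain ⟨y, hxy, hlt⟩ := hf x hxr
    refine ⟨y, hxy, ?_⟩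
    have h1 := hfM x
    have h2 := hδM y
    by_cases hyC : y ∈ C
    · simp only [hxC, hyC, if_true, if_false]
      omega
    · simpa only [hxC, hyC, if_false] using hlt

theorem comp_subset_of_large {Q Q' : Finset V} {r r' : V} (hQ : Q ⊆ Q')
    (h : Fintype.card V < 2 * (G.comp Q r).card)
    (h' : Fintype.card V < 2 * (G.comp Q' r').card) : G.comp Q' r' ⊆ G.comp Q r := by
  classical
  obtain ⟨z, hz⟩ : (G.comp Q r ∩ G.comp Q' r').Nonempty := by
    rw [← Finset.card_pos]
    have h1 := Finset.card_union_add_card_inter (G.comp Q r) (G.comp Q' r')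
    have h2 := Finset.card_le_univ (G.comp Q r ∪ G.comp Q' r')
    omega
  rw [Finset.mem_inter, mem_comp, mem_comp] at hz
  intro x hx
  exact mem_comp.2 (hz.1.trans ((hz.2.symm.trans (mem_comp.1 hx)).mono (isolate_anti hQ)))

theorem notMem_of_mem_comp {Q : Finset V} {r v : V} (h : 1 < (G.comp Q r).card)
    (hv : v ∈ G.comp Q r) : v ∉ Q := by
  classical
  obtain ⟨w, hw, hne⟩ := Finset.exists_mem_ne h v
  obtain ⟨p⟩ := (mem_comp.1 hv).symm.trans (mem_comp.1 hw)
  cases p with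
  | nil => exact (hne rfl).elim
  | cons h _ => exact h.2.1

end SimpleGraph

namespace FairDivision.QueryAlgorithm

open SimpleGraph

/-- The adversary. Its state consists of the set `Q` of relevant queries so far, the large component
of the graph without `Q`, and a function `f` with no local maximum outside this component, whose
values outside the component are final. A query in the component moves the only candidate for a
local maximum to the large component that remains; all other answers are already fixed. -/
theorem exists_hard_function_of_state {V : Type} [Fintype V] [Nontrivial V] {G : SimpleGraph V}
    {t : ℕ} (hG : ∀ Q : Finset V, Q.card ≤ t → ∃ r, Fintype.card V < 2 * (G.comp Q r).card)
    (A : QueryAlgorithm V ℕ V) :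
    ∀ (Q : Finset V) (f : V → ℕ) (r : V), Fintype.card V < 2 * (G.comp Q r).card →
      G.NoLocalMaxExcept f r → ∃ f' : V → ℕ, (∀ x ∉ G.comp Q r, f' x = f x) ∧
        (t < A.numQueries f' + Q.card ∨ ∃ y, G.Adj (A.run f') y ∧ f' (A.run f') < f' y) := by
  classical
  have hV : 1 < Fintype.card V := Fintype.one_lt_card
  induction A with
  | output o =>
    intro Q f r hr hf
    by_cases ho : o = r
    · obtain ⟨r', hr', hne⟩ := Finset.exists_mem_ne (s := G.comp Q r) (by omega) o
      obtain ⟨f', hf', hloc⟩ := hf.move hr'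
      exact ⟨f', hf', Or.inr (hloc o hne.symm)⟩
    · exact ⟨f, fun _ _ => rfl, Or.inr (hf o ho)⟩
  | query v next ih =>
    intro Q f r hr hf
    by_cases hv : v ∈ G.comp Q r
    · by_cases ht : (insert v Q).card ≤ t
      · obtain ⟨r', hr'⟩ := hG _ ht
        have hsub := comp_subset_of_large (Finset.subset_insert v Q) hr hr'
        have hv' : v ∉ G.comp (insert v Q) r' := fun h =>
          notMem_of_mem_comp (by omega) h (Finset.mem_insert_self v Q)
        obtain ⟨f₁, hf₁, hloc⟩ := hf.move (hsub (mem_comp.2 (Reachable.refl r')))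
        obtain ⟨f₂, hf₂, h⟩ := ih (f₁ v) (insert v Q) f₁ r' hr' hloc
        refine ⟨f₂, fun x hx => (hf₂ x fun h => hx (hsub h)).trans (hf₁ x hx), ?_⟩
        rw [numQueries, run, hf₂ v hv']
        refine h.imp (fun h => ?_) id
        have := Finset.card_insert_le v Q
        omega
      · refine ⟨f, fun _ _ => rfl, Or.inl ?_⟩
        have := Finset.card_insert_le v Q
        rw [numQueries]
        omega
    · obtain ⟨f', hf', h⟩ := ih (f v) Q f r hr hf
      refine ⟨f', hf', ?_⟩
      rw [numQueries, run, hf' v hv]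
      exact h.imp (fun h => by omega) id

/-- A deterministic algorithm that finds local maxima on an arc-transitive graph of diameter at most
`D` with `N` vertices makes at least `N / (4 * D)` queries on some input. -/
theorem card_le_mul_numQueries {V : Type} [Fintype V] [Nonempty V] {G : SimpleGraph V}
    [DecidableRel G.Adj] (hG : G.IsArcTransitive) {d D : ℕ} (hd : G.IsRegularOfDegree d)
    (hd0 : 0 < d) (hD : ∀ u v, ∃ p : G.Walk u v, p.length ≤ D) (A : QueryAlgorithm V ℕ V)
    (hA : ∀ (f : V → ℕ) y, G.Adj (A.run f) y → f y ≤ f (A.run f)) :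
    ∃ f, Fintype.card V ≤ 4 * D * A.numQueries f := by
  classical
  obtain ⟨u⟩ := ‹Nonempty V›
  obtain ⟨w, huw⟩ := (G.degree_pos_iff_exists_adj u).1 ((hd.degree_eq u).symm ▸ hd0)
  have : Nontrivial V := ⟨u, w, huw.ne⟩
  by_contra! hcon
  have hDpos : 0 < D := by
    obtain ⟨p, hp⟩ := hD u w
    cases p with
    | nil => exact (huw.ne rfl).elim
    | cons h p => rw [Walk.length_cons] at hp; omega
  -- the largest size of a set to which `exists_large_comp` applies
  set t := (Fintype.card V - 1) / (4 * D) with ht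
  have hpos : 0 < Fintype.card V := Fintype.card_pos
  have hlarge : ∀ Q : Finset V, Q.card ≤ t →
      ∃ r, Fintype.card V < 2 * (G.comp Q r).card := by
    intro Q hQ
    refine hG.exists_large_comp hd hd0 hD ?_
    have h1 := Nat.mul_le_mul_left (4 * D) hQ
    have h2 := Nat.mul_div_le (Fintype.card V - 1) (4 * D)
    rw [← ht] at h2
    omega
  obtain ⟨r, hr⟩ := hlarge ∅ (by simp)
  -- minus the distance from `r`, made nonnegative, has its only local maximum at `r`
  obtain ⟨f, hf⟩ : ∃ f : V → ℕ, G.NoLocalMaxExcept f r := by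
    refine ⟨fun x => ∑ y, G.dist r y - G.dist r x, fun x hx => ?_⟩
    obtain ⟨p⟩ : G.Reachable x r := ⟨(hD x r).choose⟩
    obtain ⟨p, hp⟩ := p.reachable.exists_walk_length_eq_dist
    cases p with
    | nil => exact (hx rfl).elim
    | @cons _ y _ hxy p =>
      refine ⟨y, hxy, ?_⟩
      have h1 : G.dist y r ≤ p.length := dist_le p
      have h2 : G.dist r x ≤ ∑ y, G.dist r y :=
        Finset.single_le_sum (f := fun x => G.dist r x) (fun _ _ => Nat.zero_le _)
          (Finset.mem_univ x)
      rw [Walk.length_cons, G.dist_comm] at hp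
      rw [G.dist_comm] at h1
      change ∑ y, G.dist r y - G.dist r x < ∑ y, G.dist r y - G.dist r y
      omega
  obtain ⟨f', -, h⟩ := exists_hard_function_of_state hlarge A ∅ f r hr hf
  rcases h with h | ⟨y, hy, hlt⟩
  · have h1 := hcon f'
    rw [Finset.card_empty, add_zero, ht, Nat.div_lt_iff_lt_mul (by omega), mul_comm] at h
    omega
  · exact absurd (hA f' y hy) (by omega)

end FairDivision.QueryAlgorithm

/-! ### The odd graph -/

namespace FairDivision

/-- The sets of `k` goods out of `2 * k + 1`, the vertices of the odd graph. -/
abbrev KSet (k : ℕ) : Type := {S : Finset (Fin (2 * k + 1)) // S.card = k}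

/-- The odd graph, that is, the Kneser graph of the `k`-subsets of a set of size `2 * k + 1`:
disjoint sets are adjacent. For `k = 0` it has no edges. -/
def oddGraph (k : ℕ) : SimpleGraph (KSet k) where
  Adj A B := A ≠ B ∧ Disjoint A.1 B.1
  symm := ⟨fun _ _ h => ⟨h.1.symm, h.2.symm⟩⟩
  loopless := ⟨fun _ h => h.1 rfl⟩

instance (k : ℕ) : DecidableRel (oddGraph k).Adj :=
  fun A B => inferInstanceAs (Decidable (A ≠ B ∧ Disjoint A.1 B.1))

theorem KSet.card_eq (k : ℕ) : Fintype.card (KSet k) = (2 * k + 1).choose k := by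
  rw [Fintype.card_finset_len, Fintype.card_fin]

theorem KSet.nonempty (k : ℕ) : Nonempty (KSet k) := by
  rw [← Fintype.card_pos_iff, KSet.card_eq]
  exact Nat.choose_pos (by omega)

theorem oddGraph_adj {k : ℕ} (hk : 1 ≤ k) {A B : KSet k} :
    (oddGraph k).Adj A B ↔ Disjoint A.1 B.1 := by
  refine ⟨fun h => h.2, fun h => ⟨?_, h⟩⟩
  rintro rfl
  have := A.2
  rw [disjoint_self.1 h] at this
  simp at this
  omega

theorem oddGraph_regular {k : ℕ} (hk : 1 ≤ k) : (oddGraph k).IsRegularOfDegree (k + 1) := by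
  intro A
  have hcard : (A.1ᶜ.powersetCard k).card = k + 1 := by
    rw [Finset.card_powersetCard, Finset.card_compl, A.2, Fintype.card_fin,
      show 2 * k + 1 - k = k + 1 by omega, Nat.choose_succ_self_right]
  rw [← hcard, ← SimpleGraph.card_neighborFinset_eq_degree,
    ← Finset.card_map (Function.Embedding.subtype _)]
  congr 1
  ext S
  simp only [Finset.mem_map, SimpleGraph.mem_neighborFinset, Function.Embedding.subtype_apply,
    Finset.mem_powersetCard, oddGraph_adj hk]
  constructor
  · rintro ⟨B, hB, rfl⟩
    exact ⟨Finset.subset_compl_iff_disjoint_left.2 hB, B.2⟩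
  · rintro ⟨h, hS⟩
    exact ⟨⟨S, hS⟩, Finset.subset_compl_iff_disjoint_left.1 h, rfl⟩

/-- The automorphism of the odd graph induced by a permutation of the goods. -/
def oddGraphAut (k : ℕ) (σ : Equiv.Perm (Fin (2 * k + 1))) : oddGraph k ≃g oddGraph k where
  toEquiv := (Equiv.finsetCongr σ).subtypeEquiv fun S => by simp
  map_rel_iff' := by
    intro A B
    simp [oddGraph, Subtype.ext_iff]

/-- A permutation of a finite type can move any two disjoint sets to any two others of the same
sizes. -/
theorem exists_perm_map_eq {α : Type*} [Fintype α] [DecidableEq α] {A B A' B' : Finset α}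
    (hAB : Disjoint A B) (hAB' : Disjoint A' B') (hA : A.card = A'.card)
    (hB : B.card = B'.card) :
    ∃ σ : Equiv.Perm α, A.map σ.toEmbedding = A' ∧ B.map σ.toEmbedding = B' := by
  -- the colour of an element records the sets that contain it
  let χ : Finset α → Finset α → α → Bool × Bool := fun A B x => (decide (x ∈ A), decide (x ∈ B))
  have hcol : ∀ A B : Finset α, Disjoint A B →
      Fintype.card {x // χ A B x = (true, true)} = 0 ∧
      Fintype.card {x // χ A B x = (true, false)} = A.card ∧
      Fintype.card {x // χ A B x = (false, true)} = B.card ∧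
      Fintype.card {x // χ A B x = (false, false)} = Fintype.card α - (A.card + B.card) := by
    intro A B h
    have hd : ∀ x ∈ A, x ∉ B := fun x hx => Finset.disjoint_left.1 h hx
    refine ⟨?_, ?_, ?_, ?_⟩
    · rw [Fintype.card_eq_zero_iff]
      exact ⟨fun x => hd x.1 (by simpa [χ] using congrArg Prod.fst x.2)
        (by simpa [χ] using congrArg Prod.snd x.2)⟩
    · refine Fintype.card_of_subtype _ fun x => ?_
      have := hd x
      simp only [χ, Prod.mk.injEq, decide_eq_true_eq, decide_eq_false_iff_not]
      tauto
    · refine Fintype.card_of_subtype _ fun x => ?_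
      have := hd x
      simp only [χ, Prod.mk.injEq, decide_eq_true_eq, decide_eq_false_iff_not]
      tauto
    · rw [← Finset.card_union_of_disjoint h, ← Finset.card_compl]
      refine Fintype.card_of_subtype _ fun x => ?_
      simp [χ]
  have hfib : ∀ c, Nonempty ({x // χ A B x = c} ≃ {x // χ A' B' x = c}) := by
    intro c
    rw [← Fintype.card_eq]
    obtain ⟨h1, h2, h3, h4⟩ := hcol A B hAB
    obtain ⟨h1', h2', h3', h4'⟩ := hcol A' B' hAB'
    rcases c with ⟨_ | _, _ | _⟩ <;> omega
  let σ : Equiv.Perm α := Equiv.ofFiberEquiv fun c => (hfib c).some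
  have hσ : ∀ x, χ A' B' (σ x) = χ A B x := fun x => Equiv.ofFiberEquiv_map _ x
  simp only [χ, Prod.mk.injEq, decide_eq_decide] at hσ
  refine ⟨σ, ?_, ?_⟩ <;>
  · ext y
    have := hσ (σ.symm y)
    rw [Equiv.apply_symm_apply] at this
    simp [Finset.mem_map_equiv, this]

theorem oddGraph_isArcTransitive (k : ℕ) : (oddGraph k).IsArcTransitive := by
  intro A B A' B' h h'
  obtain ⟨σ, hA, hB⟩ := exists_perm_map_eq h.2 h'.2 (A.2.trans A'.2.symm) (B.2.trans B'.2.symm)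
  exact ⟨oddGraphAut k σ, Subtype.ext hA, Subtype.ext hB⟩

/-- Exchanging one element of a vertex takes two steps in the odd graph: both sets are disjoint from
the complement of their union, which has `k` elements. -/
theorem oddGraph_exists_walk {k : ℕ} (hk : 1 ≤ k) (A B : KSet k) :
    ∃ p : (oddGraph k).Walk A B, p.length ≤ 2 * k := by
  suffices h : ∀ n, ∀ A : KSet k, (A.1 \ B.1).card = n →
      ∃ p : (oddGraph k).Walk A B, p.length ≤ 2 * n by
    obtain ⟨p, hp⟩ := h _ A rfl
    have := Finset.card_le_card (Finset.sdiff_subset (s := A.1) (t := B.1))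
    rw [A.2] at this
    exact ⟨p, by omega⟩
  intro n
  induction n with
  | zero =>
    intro A hA
    obtain rfl : A = B := Subtype.ext <| Finset.eq_of_subset_of_card_le
      (Finset.sdiff_eq_empty_iff_subset.1 (Finset.card_eq_zero.1 hA)) (by rw [A.2, B.2])
    exact ⟨.nil, by simp⟩
  | succ n ih =>
    intro A hA
    have hBA : (B.1 \ A.1).card = n + 1 := by
      rw [← hA]
      exact (Finset.card_sdiff_comm (by rw [A.2, B.2])).symm
    obtain ⟨x, hx⟩ := Finset.card_pos.1 (show 0 < (A.1 \ B.1).card by omega)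
    obtain ⟨y, hy⟩ := Finset.card_pos.1 (show 0 < (B.1 \ A.1).card by omega)
    rw [Finset.mem_sdiff] at hx hy
    have hxy : x ≠ y := fun h => hy.2 (h ▸ hx.1)
    have hA' : (insert y (A.1.erase x)).card = k := by
      rw [Finset.card_insert_of_notMem (fun h => hy.2 (Finset.mem_of_mem_erase h)),
        Finset.card_erase_of_mem hx.1, A.2]
      omega
    have hD : ((insert y A.1)ᶜ).card = k := by
      rw [Finset.card_compl, Finset.card_insert_of_notMem hy.2, A.2, Fintype.card_fin]
      omega
    obtain ⟨p, hp⟩ := ih ⟨insert y (A.1.erase x), hA'⟩ (by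
      have : insert y (A.1.erase x) \ B.1 = (A.1 \ B.1).erase x := by
        ext z
        simp only [Finset.mem_sdiff, Finset.mem_insert, Finset.mem_erase]
        constructor
        · rintro ⟨rfl | h, hz⟩
          · exact (hz hy.1).elim
          · exact ⟨h.1, h.2, hz⟩
        · rintro ⟨h1, h2, h3⟩
          exact ⟨Or.inr ⟨h1, h2⟩, h3⟩
      rw [this, Finset.card_erase_of_mem (Finset.mem_sdiff.2 hx), hA]
      omega)
    have h1 : (oddGraph k).Adj A ⟨_, hD⟩ := (oddGraph_adj hk).2 <|
      disjoint_compl_right_iff.2 (Finset.subset_insert y A.1)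
    have h2 : (oddGraph k).Adj ⟨_, hD⟩ ⟨insert y (A.1.erase x), hA'⟩ := (oddGraph_adj hk).2 <|
      disjoint_compl_left_iff.2 <|
        Finset.insert_subset_insert y (Finset.erase_subset x A.1)
    exact ⟨.cons h1 (.cons h2 p), by simp only [SimpleGraph.Walk.length_cons]; omega⟩

/-! ### From local search to query complexity -/

namespace QueryAlgorithm

variable {Q R O V : Type}

/-- The algorithm for functions `f : V → ℕ` that runs `A`, replacing a query `q` by the query `w q`
and passing `a q (f (w q))` to `A` as the answer, and translates the output by `dec`. -/
def simulate (w : Q → V) (a : Q → ℕ → R) (dec : O → V) :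
    QueryAlgorithm Q R O → QueryAlgorithm V ℕ V
  | output o => output (dec o)
  | query q next => query (w q) fun n => simulate w a dec (next (a q n))

theorem run_simulate (w : Q → V) (a : Q → ℕ → R) (dec : O → V) (A : QueryAlgorithm Q R O)
    (f : V → ℕ) : (A.simulate w a dec).run f = dec (A.run fun q => a q (f (w q))) := by
  induction A with
  | output o => rfl
  | query q next ih => exact ih _

theorem numQueries_simulate (w : Q → V) (a : Q → ℕ → R) (dec : O → V)
    (A : QueryAlgorithm Q R O) (f : V → ℕ) :
    (A.simulate w a dec).numQueries f = A.numQueries fun q => a q (f (w q)) := by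
  induction A with
  | output o => rfl
  | query q next ih => exact congrArg (· + 1) (ih _)

end QueryAlgorithm

/-- A search problem is hard if local search on the odd graph reduces to it: `inst f` is the input
that encodes the function `f`, each query to it needs only one value of `f`, and its valid outputs
reveal local maxima of `f`. -/
theorem le_detQueryComplexity_of_reduction {k : ℕ} (hk : 1 ≤ k) {I Q R O : Type}
    {oracle : I → Q → R} {valid : I → Set O} (inst : (KSet k → ℕ) → I)
    (w : Q → KSet k) (a : Q → ℕ → R) (dec : O → KSet k)
    (hquery : ∀ f q, oracle (inst f) q = a q (f (w q)))
    (hdec : ∀ f, ∀ o ∈ valid (inst f), ∀ B, (oddGraph k).Adj (dec o) B → f B ≤ f (dec o)) :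
    ENNReal.ofReal (1 / 8 * (1 / (k : ℝ) * ((2 * k + 1).choose k : ℝ))) ≤
      (detQueryComplexity oracle valid : ℝ≥0∞) := by
  have key : ((⌈1 / 8 * (1 / (k : ℝ) * ((2 * k + 1).choose k : ℝ))⌉₊ : ℕ) : ℕ∞) ≤
      detQueryComplexity oracle valid := by
    refine le_iInf₂ fun A hA => ?_
    have := KSet.nonempty k
    have horacle : ∀ f, (fun q => a q (f (w q))) = oracle (inst f) :=
      fun f => funext fun q => (hquery f q).symm
    obtain ⟨f, hf⟩ := QueryAlgorithm.card_le_mul_numQueries (oddGraph_isArcTransitive k)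
      (oddGraph_regular hk) k.succ_pos (oddGraph_exists_walk hk) (A.simulate w a dec) (by
        intro f B hB
        rw [QueryAlgorithm.run_simulate, horacle] at hB ⊢
        exact hdec f _ (hA (inst f)) B hB)
    rw [QueryAlgorithm.numQueries_simulate, horacle, KSet.card_eq] at hf
    refine le_trans ?_ (le_iSup (fun x => (A.numQueries (oracle x) : ℕ∞)) (inst f))
    rw [Nat.cast_le, Nat.ceil_le]
    have hk' : (0 : ℝ) < k := by exact_mod_cast hk
    have hf' : ((2 * k + 1).choose k : ℝ) ≤ 4 * (2 * k) * A.numQueries (oracle (inst f)) := by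
      exact_mod_cast hf
    calc 1 / 8 * (1 / (k : ℝ) * ((2 * k + 1).choose k : ℝ))
        ≤ 1 / 8 * (1 / (k : ℝ) * (4 * (2 * k) * A.numQueries (oracle (inst f)))) := by gcongr
      _ = A.numQueries (oracle (inst f)) := by field_simp; ring
  refine le_trans ?_ (ENat.toENNReal_le.2 key)
  rw [ENat.toENNReal_coe, ← ENNReal.ofReal_natCast]
  exact ENNReal.ofReal_le_ofReal (Nat.le_ceil _)

end FairDivision

/-! ### Valuations whose EFX allocations are local maxima -/

namespace FairDivision

/-- A strictly increasing map from `ℕ` into `[0, 1/2]`. -/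
noncomputable def squash (n : ℕ) : ℝ := 1 / 2 - 1 / (n + 2)

theorem squash_nonneg (n : ℕ) : 0 ≤ squash n := by
  have h : (1 : ℝ) / (n + 2) ≤ 1 / 2 :=
    one_div_le_one_div_of_le two_pos (by linarith [n.cast_nonneg (α := ℝ)])
  unfold squash
  linarith

theorem squash_le (n : ℕ) : squash n ≤ 1 / 2 := by
  have h : (0 : ℝ) ≤ 1 / (n + 2) := by positivity
  unfold squash
  linarith

theorem squash_strictMono : StrictMono squash := by
  intro a b hab
  have hab' : (a : ℝ) < b := by exact_mod_cast hab
  have h : (1 : ℝ) / (b + 2) < 1 / (a + 2) :=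
    one_div_lt_one_div_of_lt (by positivity) (by linarith)
  unfold squash
  linarith

/-- The value of a set `S` of goods: a strictly concave increasing function of its size and, if
`S` has `k` elements, a perturbation that encodes the number `n`. -/
noncomputable def codeValue (k : ℕ) (S : Finset (Fin (2 * k + 1))) (n : ℕ) : ℝ :=
  (S.card : ℝ) * (4 * k + 4 - S.card) + if S.card = k then squash n else 0

open scoped Classical in
/-- A vertex of the odd graph that is `S` itself if `S` has `k` elements. -/
noncomputable def toKSet (k : ℕ) (S : Finset (Fin (2 * k + 1))) : KSet k :=
  if h : S.card = k then ⟨S, h⟩ else (KSet.nonempty k).some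

theorem toKSet_of_card {k : ℕ} {S : Finset (Fin (2 * k + 1))} (h : S.card = k) :
    toKSet k S = ⟨S, h⟩ := dif_pos h

theorem codeValue_ge (k : ℕ) (S : Finset (Fin (2 * k + 1))) (n : ℕ) :
    (S.card : ℝ) * (4 * k + 4 - S.card) ≤ codeValue k S n := by
  unfold codeValue
  split_ifs
  · linarith [squash_nonneg n]
  · linarith

theorem codeValue_le (k : ℕ) (S : Finset (Fin (2 * k + 1))) (n : ℕ) :
    codeValue k S n ≤ (S.card : ℝ) * (4 * k + 4 - S.card) + 1 / 2 := by
  unfold codeValue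
  split_ifs
  · linarith [squash_le n]
  · linarith

/-- The size of a set dominates its value. -/
theorem codeValue_lt {k : ℕ} {S T : Finset (Fin (2 * k + 1))} (h : S.card < T.card) (n n' : ℕ) :
    codeValue k S n < codeValue k T n' := by
  refine (codeValue_le k S n).trans_lt (lt_of_lt_of_le ?_ (codeValue_ge k T n'))
  have hT : (T.card : ℝ) ≤ 2 * k + 1 := by
    exact_mod_cast (Finset.card_le_univ T).trans_eq (Fintype.card_fin _)
  have hST : (S.card : ℝ) + 1 ≤ T.card := by exact_mod_cast h
  nlinarith

/-- The valuation that encodes a function on the vertices of the odd graph. -/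
noncomputable def codeValuation {k : ℕ} (hk : 1 ≤ k) (f : KSet k → ℕ) :
    Valuation (2 * k + 1) where
  val S := codeValue k S (f (toKSet k S))
  val_empty := by
    have h : ¬ 0 = k := by omega
    simp [codeValue, h]
  val_mono S T hST := by
    rcases (Finset.card_le_card hST).lt_or_eq with h | h
    · exact (codeValue_lt h _ _).le
    · rw [Finset.eq_of_subset_of_card_le hST h.ge]

theorem codeValuation_val {k : ℕ} (hk : 1 ≤ k) (f : KSet k → ℕ)
    (S : Finset (Fin (2 * k + 1))) :
    (codeValuation hk f).val S = codeValue k S (f (toKSet k S)) := rfl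

theorem codeValuation_val_of_card {k : ℕ} (hk : 1 ≤ k) (f : KSet k → ℕ)
    {S : Finset (Fin (2 * k + 1))} (h : S.card = k) :
    (codeValuation hk f).val S = k * (4 * k + 4 - k) + squash (f ⟨S, h⟩) := by
  rw [codeValuation_val, codeValue, toKSet_of_card h, if_pos h, h]

theorem codeValuation_isSubmodular {k : ℕ} (hk : 1 ≤ k) (f : KSet k → ℕ) :
    (codeValuation hk f).IsSubmodular := by
  intro S T x hST hx
  have hxS : x ∉ S := fun h => hx (hST h)
  rcases (Finset.card_le_card hST).lt_or_eq with h | h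
  · -- the marginal value of the size drops by at least 2, and each perturbation is at most 1/2
    have h1 := codeValue_ge k S (f (toKSet k S))
    have h2 := codeValue_le k S (f (toKSet k S))
    have h3 := codeValue_ge k T (f (toKSet k T))
    have h4 := codeValue_le k T (f (toKSet k T))
    have h5 := codeValue_ge k (insert x S) (f (toKSet k (insert x S)))
    have h6 := codeValue_le k (insert x T) (f (toKSet k (insert x T)))
    rw [Finset.card_insert_of_notMem hxS] at h5
    rw [Finset.card_insert_of_notMem hx] at h6
    push_cast at h5 h6
    simp only [codeValuation_val]
    have hlt : (S.card : ℝ) + 1 ≤ T.card := by exact_mod_cast h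
    nlinarith
  · rw [Finset.eq_of_subset_of_card_le hST h.ge]

theorem Allocation.bundle_one_eq_compl {m : ℕ} (A : Allocation 2 m) :
    A.bundle 1 = (A.bundle 0)ᶜ := by
  ext g
  rw [Finset.mem_compl]
  constructor
  · exact fun h h' => Finset.disjoint_left.1 (A.disjoint 0 1 (by decide)) h' h
  · intro h
    obtain ⟨i, hi⟩ := A.cover g
    fin_cases i
    · exact (h hi).elim
    · exact hi

theorem Allocation.card_bundle_add_card_bundle {m : ℕ} (A : Allocation 2 m) :
    (A.bundle 0).card + (A.bundle 1).card = m := by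
  rw [A.bundle_one_eq_compl, Finset.card_add_card_compl, Fintype.card_fin]

theorem Allocation.bundle_eq_compl {m : ℕ} (A : Allocation 2 m) {i j : Fin 2} (hij : i ≠ j) :
    A.bundle j = (A.bundle i)ᶜ := by
  fin_cases i <;> fin_cases j
  · exact (hij rfl).elim
  · exact A.bundle_one_eq_compl
  · exact (compl_eq_comm.1 A.bundle_one_eq_compl.symm).symm
  · exact (hij rfl).elim

/-- The vertex of the odd graph that an allocation reveals: the bundle that has `k` elements, if
there is one. -/
noncomputable def Allocation.toKSet {k : ℕ} (A : Allocation 2 (2 * k + 1)) : KSet k :=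
  FairDivision.toKSet k (if (A.bundle 0).card = k then A.bundle 0 else A.bundle 1)

/-- An allocation that is EFX for a valuation encoding a function is balanced, and removing single
goods from the larger bundle yields exactly the neighbours of the smaller one. -/
theorem Allocation.IsEFX.isLocalMax {k : ℕ} (hk : 1 ≤ k) {f : KSet k → ℕ}
    {A : Allocation 2 (2 * k + 1)} (hA : A.IsEFX fun _ => codeValuation hk f) (B : KSet k)
    (hB : (oddGraph k).Adj A.toKSet B) : f B ≤ f A.toKSet := by
  have hsum := A.card_bundle_add_card_bundle
  -- otherwise the larger bundle keeps more than `k` elements after the removal of a good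
  have hbal : ∀ i j, (A.bundle i).card + (A.bundle j).card = 2 * k + 1 →
      k ≤ (A.bundle i).card := by
    intro i j hij
    by_contra! hlt
    obtain ⟨g, hg⟩ := Finset.card_pos.1 (show 0 < (A.bundle j).card by omega)
    refine absurd (hA i j g hg) (not_le.2 (codeValue_lt ?_ _ _))
    rw [Finset.sdiff_singleton_eq_erase, Finset.card_erase_of_mem hg]
    omega
  have h0 := hbal 0 1 hsum
  have h1 := hbal 1 0 (by omega)
  obtain ⟨i, j, hij, hi, hAi⟩ : ∃ i j : Fin 2, i ≠ j ∧ (A.bundle i).card = k ∧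
      A.toKSet = FairDivision.toKSet k (A.bundle i) := by
    by_cases h : (A.bundle 0).card = k
    · exact ⟨0, 1, by decide, h, by rw [toKSet, if_pos h]⟩
    · exact ⟨1, 0, by decide, by omega, by rw [toKSet, if_neg h]⟩
  rw [hAi, toKSet_of_card hi] at hB ⊢
  have hj := A.bundle_eq_compl hij
  have hBj : B.1 ⊆ A.bundle j := by
    rw [hj]
    exact Finset.subset_compl_iff_disjoint_left.2 hB.2
  obtain ⟨g, hg⟩ : ∃ g, A.bundle j \ B.1 = {g} := by
    rw [← Finset.card_eq_one, Finset.card_sdiff_of_subset hBj, hj, Finset.card_compl, hi, B.2,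
      Fintype.card_fin]
    omega
  have hgj : g ∈ A.bundle j := (Finset.mem_sdiff.1 (hg ▸ Finset.mem_singleton_self g)).1
  have hle := hA i j g hgj
  dsimp only at hle
  rw [← hg, Finset.sdiff_sdiff_eq_self hBj, codeValuation_val_of_card hk f hi,
    codeValuation_val_of_card hk f B.2] at hle
  exact squash_strictMono.le_iff_le.1 (by linarith)

/-- A global maximum of `f` and its complement form an EFX allocation. -/
theorem exists_isEFX_codeValuation {k : ℕ} (hk : 1 ≤ k) (f : KSet k → ℕ) :
    ∃ A : Allocation 2 (2 * k + 1), A.IsEFX fun _ => codeValuation hk f := by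
  have := KSet.nonempty k
  obtain ⟨S, hS⟩ := Finite.exists_max f
  have hcompl : (S.1ᶜ).card = k + 1 := by
    rw [Finset.card_compl, S.2, Fintype.card_fin]
    omega
  refine ⟨⟨![S.1, S.1ᶜ], ?_, ?_⟩, ?_⟩
  · intro i j hij
    fin_cases i <;> fin_cases j
    · exact (hij rfl).elim
    · exact disjoint_compl_right
    · exact disjoint_compl_left
    · exact (hij rfl).elim
  · intro g
    by_cases hg : g ∈ S.1
    · exact ⟨0, hg⟩
    · exact ⟨1, Finset.mem_compl.2 hg⟩
  · intro i j g hg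
    have hmono : ∀ T : Finset (Fin (2 * k + 1)),
        (codeValuation hk f).val (T \ {g}) ≤ (codeValuation hk f).val T :=
      fun T => (codeValuation hk f).val_mono _ _ Finset.sdiff_subset
    fin_cases i <;> fin_cases j
    · exact hmono _
    · change g ∈ S.1ᶜ at hg
      change (codeValuation hk f).val (S.1ᶜ \ {g}) ≤ (codeValuation hk f).val S.1
      have hcard : (S.1ᶜ \ {g}).card = k := by
        rw [Finset.sdiff_singleton_eq_erase, Finset.card_erase_of_mem hg, hcompl]
        rfl
      rw [codeValuation_val_of_card hk f hcard, codeValuation_val_of_card hk f S.2]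
      have := squash_strictMono.monotone (hS ⟨_, hcard⟩)
      linarith
    · change (codeValuation hk f).val (S.1 \ {g}) ≤ (codeValuation hk f).val S.1ᶜ
      refine (hmono _).trans (codeValue_lt ?_ _ _).le
      rw [S.2, hcompl]
      exact k.lt_succ_self
    · exact hmono _

theorem le_efxIdComplexityOn {k : ℕ} (hk : 1 ≤ k) {C : Set (Valuation (2 * k + 1))}
    (hC : ∀ f, codeValuation hk f ∈ C) :
    ENNReal.ofReal (1 / 8 * (1 / (k : ℝ) * ((2 * k + 1).choose k : ℝ))) ≤
      (efxIdComplexityOn 2 (2 * k + 1) C : ℝ≥0∞) :=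
  le_detQueryComplexity_of_reduction hk (fun f => ⟨codeValuation hk f, hC f⟩) (toKSet k)
    (codeValue k) Allocation.toKSet (fun _ _ => rfl) fun _ _ hA => hA.isLocalMax hk

theorem le_efxComplexity {k : ℕ} (hk : 1 ≤ k) :
    ENNReal.ofReal (1 / 8 * (1 / (k : ℝ) * ((2 * k + 1).choose k : ℝ))) ≤
      (efxComplexity 2 (2 * k + 1) : ℝ≥0∞) := by
  refine le_detQueryComplexity_of_reduction hk (fun f _ => codeValuation hk f)
    (fun q => toKSet k q.2) (fun q => codeValue k q.2)
    (fun o => o.elim (KSet.nonempty k).some Allocation.toKSet) (fun _ _ => rfl) ?_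
  rintro f o (⟨A, rfl, hA⟩ | ⟨-, hnone⟩)
  · exact hA.isLocalMax hk
  · exact (hnone (exists_isEFX_codeValuation hk f)).elim

end FairDivision

theorem mainTheorem1 :
    ∃ c : ℝ, 0 < c ∧ ∀ k : ℕ, 1 ≤ k →
      ENNReal.ofReal (c * (1 / (k : ℝ) * ((2 * k + 1).choose k : ℝ))) ≤
          (FairDivision.efxIdComplexityOn 2 (2 * k + 1)
            {v : FairDivision.Valuation (2 * k + 1) | v.IsSubmodular} : ℝ≥0∞) ∧
      ENNReal.ofReal (c * (1 / (k : ℝ) * ((2 * k + 1).choose k : ℝ))) ≤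
          (FairDivision.efxIdComplexity 2 (2 * k + 1) : ℝ≥0∞) ∧
      ENNReal.ofReal (c * (1 / (k : ℝ) * ((2 * k + 1).choose k : ℝ))) ≤
          (FairDivision.efxComplexity 2 (2 * k + 1) : ℝ≥0∞) := by
  refine ⟨1 / 8, by norm_num, fun k hk => ⟨?_, ?_, FairDivision.le_efxComplexity hk⟩⟩
  · exact FairDivision.le_efxIdComplexityOn hk (FairDivision.codeValuation_isSubmodular hk)
  · exact FairDivision.le_efxIdComplexityOn hk fun _ => Set.mem_univ _
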